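/- Let $L$ be a finite-dimensional Lie algebra over an arbitrary field $F$. A subalgebra $B$ of $L$ is called a c-ideal of $L$ if there is an ideal $C$ of $L$ such that $L = B + C$ and $B \cap C \subseteq B_L$, where $B_L$ denotes the largest ideal of $L$ contained in $B$. A maximal nilpotent subalgebra of $L$ is a nilpotent subalgebra that is not properly contained in any other nilpotent subalgebra of $L$. The algebra $L$ is supersolvable if there is a chain $0 = I_0 \subseteq I_1 \subseteq \dots \subseteq I_n = L$ of ideals of $L$ with $\dim I_i = i$ for every $0 \le i \le n$. Suppose that every maximal nilpotent subalgebra of $L$ has dimension at least two. If every maximal (proper) subalgebra of each maximal nilpotent subalgebra of $L$ is a c-ideal of $L$, then $L$ is supersolvable. -/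

import Mathlib

namespace LieCIdeal

variable {F L : Type*} [Field F] [LieRing L] [LieAlgebra F L]

/-- The core `B_L` of a subalgebra `B` of `L`: the largest ideal of `L` contained in `B`. -/
def core (B : LieSubalgebra F L) : LieIdeal F L :=
  sSup {I : LieIdeal F L | I.toSubmodule ≤ B.toSubmodule}

/-- The core really is the largest ideal of `L` contained in `B`. -/
theorem isGreatest_core (B : LieSubalgebra F L) :
    IsGreatest {I : LieIdeal F L | I.toSubmodule ≤ B.toSubmodule} (core B) := by
  refine ⟨?_, fun I hI => le_sSup hI⟩
  change (core B).toSubmodule ≤ B.toSubmodule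
  rw [core, LieSubmodule.sSup_toSubmodule]
  refine sSup_le ?_
  rintro _ ⟨I, hI, rfl⟩
  exact hI

/-- A subalgebra `B` of `L` is a c-ideal of `L` if there is an ideal `C` of `L` with
`L = B + C` and `B ∩ C ≤ B_L`. -/
def IsCIdeal (B : LieSubalgebra F L) : Prop :=
  ∃ C : LieIdeal F L, B.toSubmodule ⊔ C.toSubmodule = ⊤ ∧
    B.toSubmodule ⊓ C.toSubmodule ≤ (core B).toSubmodule

/-- A maximal nilpotent subalgebra of `L`: a nilpotent subalgebra which is contained in no
strictly larger nilpotent subalgebra. -/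
def IsMaximalNilpotent (C : LieSubalgebra F L) : Prop :=
  Maximal (fun H : LieSubalgebra F L => LieRing.IsNilpotent H) C

/-- `B` is a maximal subalgebra of the subalgebra `C`: `B` is properly contained in `C`, and no
subalgebra lies strictly between `B` and `C`. -/
def IsMaximalSubalgebraOf (B C : LieSubalgebra F L) : Prop :=
  B ⋖ C

variable (F L) in
/-- `L` is supersolvable: there is a chain `0 = I 0 ≤ I 1 ≤ ⋯ ≤ I n = L` of ideals of `L` with
`dim (I i) = i` for all `i ≤ n`. -/
def IsSupersolvable : Prop :=
  ∃ (n : ℕ) (I : ℕ → LieIdeal F L), Monotone I ∧ I 0 = ⊥ ∧ I n = ⊤ ∧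
    ∀ i ≤ n, Module.finrank F (I i) = i

end LieCIdeal

/-! ### Brackets of subspaces and a Nakayama argument -/

namespace LieCIdeal

open LieModule

variable {F L : Type*} [Field F] [LieRing L] [LieAlgebra F L]

/-! Let R be the nilpotent residual. If a nilpotent B is a c-ideal with supplement K, then L/K is
nilpotent, so R ≤ K and B ∩ R lies in the core of B; hence [L, B ∩ R] ≤ B (`IsCIdeal.lie_mem`). This
is applied to hyperplanes B ⊇ [C,C] of maximal nilpotent C.

As dim C ≥ 2, each x ∈ R ∩ C lies in such a hyperplane, so [x,L] ≤ C and ad x is nilpotent: R is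
nilpotent by Engel (`isNilpotent_residual`). Now take C ⊇ R. Letting the hyperplane vary shows that
L acts on R modulo [C,C] through one character lam (`exists_character`). With a nilpotent supplement
H of R, H ∩ R ≤ [R,R], so R ∩ [C,C] ≤ [C,R], and Nakayama over C shows that each h ∈ H has only the
generalised eigenvalue lam h on R/[R,R] (`residual_le_genEig`).

So h has only the generalised eigenvalue n · lam h on R^n/R^(n+1). For a proper ideal P, either R ≤
P and L/P has a central vector, or the last power of R not inside P yields a common eigenvector in
L/P. One-dimensional ideals of the quotients build the chain. -/

/-- The span of all brackets `⁅x, y⁆` with `x ∈ C` and `y ∈ S`. -/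
def brk (C S : Submodule F L) : Submodule F L :=
  Submodule.map₂ (LinearMap.mk₂ F (fun x y : L => ⁅x, y⁆) add_lie smul_lie lie_add
    fun c x y => lie_smul c x y) C S

theorem lie_mem_brk {C S : Submodule F L} {x y : L} (hx : x ∈ C) (hy : y ∈ S) :
    ⁅x, y⁆ ∈ brk C S :=
  Submodule.apply_mem_map₂ (LinearMap.mk₂ F (fun x y : L => ⁅x, y⁆) add_lie smul_lie lie_add
    fun c x y => lie_smul c x y) hx hy

theorem brk_le {C S T : Submodule F L} : brk C S ≤ T ↔ ∀ x ∈ C, ∀ y ∈ S, ⁅x, y⁆ ∈ T :=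
  Submodule.map₂_le

theorem brk_mono {C C' S S' : Submodule F L} (h : C ≤ C') (h' : S ≤ S') :
    brk C S ≤ brk C' S' :=
  Submodule.map₂_le_map₂ h h'

theorem brk_comm (C S : Submodule F L) : brk C S = brk S C := by
  apply le_antisymm <;>
  · refine brk_le.2 fun x hx y hy => ?_
    rw [← lie_skew]
    exact neg_mem (lie_mem_brk hy hx)

theorem brk_sup (C S T : Submodule F L) : brk C (S ⊔ T) = brk C S ⊔ brk C T :=
  Submodule.map₂_sup_right _ _ _ _

theorem brk_self_le (C : LieSubalgebra F L) : brk C.toSubmodule C.toSubmodule ≤ C.toSubmodule :=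
  brk_le.2 fun _ hx _ hy => C.lie_mem hx hy

theorem exists_iterate_brk_eq_bot (C : LieSubalgebra F L) [h : LieRing.IsNilpotent C] :
    ∃ n, (brk C.toSubmodule)^[n] C.toSubmodule = ⊥ := by
  have key : ∀ n, (brk C.toSubmodule)^[n] C.toSubmodule ≤
      (lowerCentralSeries F C C n).toSubmodule.map C.toSubmodule.subtype := by
    intro n
    induction n with
    | zero => simp
    | succ n ih =>
      rw [Function.iterate_succ_apply']
      refine (brk_mono le_rfl ih).trans (brk_le.2 ?_)
      rintro x hx _ ⟨y, hy, rfl⟩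
      refine ⟨⁅(⟨x, hx⟩ : C), y⁆, ?_, rfl⟩
      rw [lowerCentralSeries_succ]
      exact LieSubmodule.lie_mem_lie (LieSubmodule.mem_top _) hy
  obtain ⟨n, hn⟩ := (isNilpotent_iff F C C).1 h
  refine ⟨n, eq_bot_iff.2 ((key n).trans ?_)⟩
  simp [hn]

/-- A Nakayama-type lemma for nilpotent subalgebras. -/
theorem le_of_le_sup_brk (C : LieSubalgebra F L) [LieRing.IsNilpotent C] {S E : Submodule F L}
    (hS : S ≤ C.toSubmodule) (hE : brk C.toSubmodule E ≤ E)
    (h : S ≤ E ⊔ brk C.toSubmodule S) : S ≤ E := by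
  have key : ∀ n, S ≤ E ⊔ (brk C.toSubmodule)^[n] C.toSubmodule := by
    intro n
    induction n with
    | zero => exact hS.trans le_sup_right
    | succ n ih =>
      rw [Function.iterate_succ_apply']
      refine h.trans (sup_le le_sup_left ((brk_mono le_rfl ih).trans ?_))
      rw [brk_sup]
      exact sup_le_sup_right hE _
  obtain ⟨n, hn⟩ := exists_iterate_brk_eq_bot C
  simpa [hn] using key n

/-- If C = Fx + [C,C], then [x,x] = 0 gives [C,C] ≤ [C,[C,C]]; Nakayama kills [C,C], and C = Fx is
too small. -/
theorem exists_notMem_span_sup_brk (C : LieSubalgebra F L) [LieRing.IsNilpotent C]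
    (hC : 2 ≤ Module.finrank F C) {x : L} (hx : x ∈ C) :
    ∃ y ∈ C, y ∉ F ∙ x ⊔ brk C.toSubmodule C.toSubmodule := by
  by_contra! hcon
  have hle : C.toSubmodule ≤ F ∙ x ⊔ brk C.toSubmodule C.toSubmodule := hcon
  have hxx : brk (F ∙ x) (F ∙ x) ≤ (⊥ : Submodule F L) := by
    refine brk_le.2 fun a ha b hb => ?_
    obtain ⟨s, rfl⟩ := Submodule.mem_span_singleton.1 ha
    obtain ⟨t, rfl⟩ := Submodule.mem_span_singleton.1 hb
    simp
  set D := brk C.toSubmodule C.toSubmodule with hD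
  have h1 : brk C.toSubmodule (F ∙ x) ≤ brk C.toSubmodule D := by
    rw [brk_comm]
    refine (brk_mono le_rfl hle).trans ?_
    rw [brk_sup]
    refine sup_le (hxx.trans bot_le) ?_
    exact brk_mono (by simpa using hx) le_rfl
  have h2 : D ≤ ⊥ ⊔ brk C.toSubmodule D := by
    rw [bot_sup_eq]
    conv_lhs => rw [hD]
    refine (brk_mono le_rfl hle).trans ?_
    rw [brk_sup]
    exact sup_le h1 le_rfl
  have h3 : D ≤ ⊥ := le_of_le_sup_brk C (brk_self_le C)
    (brk_le.2 fun a _ b hb => by simp [(Submodule.mem_bot F).1 hb]) h2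
  have h4 : C.toSubmodule ≤ F ∙ x := by
    rw [le_bot_iff.1 h3, sup_bot_eq] at hle
    exact hle
  have h5 := Submodule.finrank_mono h4
  have h6 : Module.finrank F (F ∙ x) ≤ 1 := by
    simpa using finrank_span_le_card ({x} : Set L)
  have h7 : Module.finrank F C = Module.finrank F C.toSubmodule := rfl
  omega

/-! ### The nilpotent residual and c-ideals -/

variable (F L) in
/-- The nilpotent residual: the intersection of the lower central series. -/
def residual : LieIdeal F L := ⨅ k, lowerCentralSeries F L L k

/-- L/K is a quotient of the nilpotent B, so the lower central series of L eventually falls into K.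
-/
theorem residual_le_of_sup_eq_top {B : LieSubalgebra F L} [LieRing.IsNilpotent B]
    {K : LieIdeal F L} (hBK : B.toSubmodule ⊔ K.toSubmodule = ⊤) : residual F L ≤ K := by
  obtain ⟨n, hn⟩ := exists_iterate_brk_eq_bot B
  have key : ∀ n, (lowerCentralSeries F L L n).toSubmodule ≤
      (brk B.toSubmodule)^[n] B.toSubmodule ⊔ K.toSubmodule := by
    intro n
    induction n with
    | zero => simp [hBK]
    | succ n ih =>
      rw [Function.iterate_succ_apply', lowerCentralSeries_succ,
        LieSubmodule.lieIdeal_oper_eq_linear_span', Submodule.span_le]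
      rintro _ ⟨x, -, y, hy, rfl⟩
      obtain ⟨b, hb, k, hk, rfl⟩ := Submodule.mem_sup.1 (hBK ▸ Submodule.mem_top : x ∈ _)
      obtain ⟨z, hz, l, hl, rfl⟩ := Submodule.mem_sup.1 (ih hy)
      rw [add_lie, lie_add, add_assoc]
      refine Submodule.add_mem_sup (lie_mem_brk hb hz) (add_mem (lie_mem_right F L K _ _ hl) ?_)
      exact lie_mem_left F L K _ _ hk
  refine (iInf_le _ n).trans ?_
  have := key n
  rw [hn, bot_sup_eq] at this
  exact this

/-- The only place where the c-ideal condition is unfolded: the supplement contains the residual, so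
x lies in the core. -/
theorem IsCIdeal.lie_mem {B : LieSubalgebra F L} [LieRing.IsNilpotent B] (hB : IsCIdeal B)
    {x : L} (hx : x ∈ B) (hx' : x ∈ residual F L) (h : L) : ⁅h, x⁆ ∈ B := by
  obtain ⟨K, hK, hK'⟩ := hB
  have h1 : x ∈ core B := hK' ⟨hx, residual_le_of_sup_eq_top hK hx'⟩
  exact (isGreatest_core B).1 (lie_mem_right F L (core B) h x h1)

theorem isNilpotent_of_le {B C : LieSubalgebra F L} (h : B ≤ C) [LieRing.IsNilpotent C] :
    LieRing.IsNilpotent B :=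
  (LieSubalgebra.inclusion_injective h).lieAlgebra_isNilpotent

/-- The intersection of a subalgebra with a hyperplane containing its derived algebra. -/
def kerSubalgebra (C : LieSubalgebra F L) (f : L →ₗ[F] F)
    (hf : brk C.toSubmodule C.toSubmodule ≤ LinearMap.ker f) : LieSubalgebra F L :=
  { C.toSubmodule ⊓ LinearMap.ker f with
    lie_mem' := fun {x y} hx hy =>
      (⟨C.lie_mem hx.1 hy.1, hf (lie_mem_brk hx.1 hy.1)⟩ : ⁅x, y⁆ ∈ C.toSubmodule ⊓ _) }

theorem mem_kerSubalgebra {C : LieSubalgebra F L} {f : L →ₗ[F] F}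
    {hf : brk C.toSubmodule C.toSubmodule ≤ LinearMap.ker f} {x : L} :
    x ∈ kerSubalgebra C f hf ↔ x ∈ C ∧ f x = 0 :=
  Iff.rfl

theorem kerSubalgebra_covBy {C : LieSubalgebra F L} {f : L →ₗ[F] F}
    (hf : brk C.toSubmodule C.toSubmodule ≤ LinearMap.ker f) {y : L} (hy : y ∈ C)
    (hfy : f y ≠ 0) : kerSubalgebra C f hf ⋖ C := by
  refine ⟨lt_of_le_of_ne (fun x hx => hx.1) fun h => hfy ?_, fun D hD hDC => ?_⟩
  · rw [← h] at hy
    exact hy.2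
  · obtain ⟨d, hd, hd'⟩ := SetLike.exists_of_lt hD
    have hdC := hDC.le hd
    have hfd : f d ≠ 0 := fun h => hd' ⟨hdC, h⟩
    refine hDC.not_ge fun c hc => ?_
    have : c - (f c / f d) • d ∈ kerSubalgebra C f hf :=
      ⟨C.sub_mem hc (C.smul_mem _ hdC), by simp [hfd]⟩
    have := D.add_mem (hD.le this) (D.smul_mem (f c / f d) hd)
    simpa using this

variable (F L) in
/-- Every maximal subalgebra of each maximal nilpotent subalgebra is a c-ideal. -/
def MaximalSubalgebrasAreCIdeals : Prop :=
  ∀ C : LieSubalgebra F L, IsMaximalNilpotent C →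
    ∀ B : LieSubalgebra F L, IsMaximalSubalgebraOf B C → IsCIdeal B

theorem MaximalSubalgebrasAreCIdeals.lie_mem (hc : MaximalSubalgebrasAreCIdeals F L)
    {C : LieSubalgebra F L} (hC : IsMaximalNilpotent C) {f : L →ₗ[F] F}
    (hf : brk C.toSubmodule C.toSubmodule ≤ LinearMap.ker f) {y : L} (hy : y ∈ C)
    (hfy : f y ≠ 0) {x : L} (hx : x ∈ C) (hx' : x ∈ residual F L) (hfx : f x = 0) (h : L) :
    ⁅h, x⁆ ∈ C ∧ f ⁅h, x⁆ = 0 := by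
  have := hC.1
  have hcov := kerSubalgebra_covBy hf hy hfy
  have := isNilpotent_of_le hcov.le
  exact (hc C hC _ hcov).lie_mem (mem_kerSubalgebra.2 ⟨hx, hfx⟩) hx' h

variable [FiniteDimensional F L]

theorem exists_isMaximalNilpotent_ge (D : LieSubalgebra F L) (hD : LieRing.IsNilpotent D) :
    ∃ C : LieSubalgebra F L, IsMaximalNilpotent C ∧ D ≤ C := by
  obtain ⟨C, hDC, hC⟩ := exists_maximal_ge_of_wellFoundedGT
    (fun H : LieSubalgebra F L => LieRing.IsNilpotent H) D hD
  exact ⟨C, hC, hDC⟩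

theorem exists_isMaximalNilpotent_mem (x : L) :
    ∃ C : LieSubalgebra F L, IsMaximalNilpotent C ∧ x ∈ C := by
  have hxx : ∀ a ∈ F ∙ x, ∀ b ∈ F ∙ x, ⁅a, b⁆ = 0 := by
    intro a ha b hb
    obtain ⟨s, rfl⟩ := Submodule.mem_span_singleton.1 ha
    obtain ⟨t, rfl⟩ := Submodule.mem_span_singleton.1 hb
    simp
  let D : LieSubalgebra F L :=
    { F ∙ x with
      lie_mem' := fun {a b} ha hb => by
        have := hxx a ha b hb
        simp [this] }
  have : IsLieAbelian D := ⟨fun a b => Subtype.ext (hxx a a.2 b b.2)⟩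
  obtain ⟨C, hC, hDC⟩ := exists_isMaximalNilpotent_ge D inferInstance
  exact ⟨C, hC, hDC (Submodule.mem_span_singleton_self x)⟩

variable (F L) in
theorem exists_residual_eq : ∃ k, ∀ n, k ≤ n → residual F L = lowerCentralSeries F L L n :=
  Filter.eventually_atTop.1 (eventually_iInf_lowerCentralSeries_eq F L L)

variable (F L) in
theorem lie_top_residual : ⁅(⊤ : LieIdeal F L), residual F L⁆ = residual F L := by
  obtain ⟨k, hk⟩ := exists_residual_eq F L
  conv_lhs => rw [hk k le_rfl]
  rw [← lowerCentralSeries_succ, hk (k + 1) (by omega)]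

/-! ### Nilpotency of the residual and its nilpotent supplements -/

theorem exists_lie_mem_maximalNilpotent
    (hdim : ∀ C : LieSubalgebra F L, IsMaximalNilpotent C → 2 ≤ Module.finrank F C)
    (hc : MaximalSubalgebrasAreCIdeals F L) {x : L} (hx : x ∈ residual F L) :
    ∃ C : LieSubalgebra F L, IsMaximalNilpotent C ∧ x ∈ C ∧ ∀ h : L, ⁅x, h⁆ ∈ C := by
  obtain ⟨C, hC, hxC⟩ := exists_isMaximalNilpotent_mem (F := F) x
  have := hC.1
  obtain ⟨y, hyC, hy⟩ := exists_notMem_span_sup_brk C (hdim C hC) hxC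
  obtain ⟨f, hfy, hf⟩ := Submodule.exists_le_ker_of_notMem hy
  refine ⟨C, hC, hxC, fun h => ?_⟩
  rw [← lie_skew]
  exact C.neg_mem (hc.lie_mem hC (le_sup_right.trans hf) hyC hfy hxC hx
    ((le_sup_left.trans hf) (Submodule.mem_span_singleton_self x)) h).1

/-- One application of ad x lands in a nilpotent C containing x, and further ones descend its lower
central series; Engel's theorem concludes. -/
theorem isNilpotent_residual
    (hdim : ∀ C : LieSubalgebra F L, IsMaximalNilpotent C → 2 ≤ Module.finrank F C)
    (hc : MaximalSubalgebrasAreCIdeals F L) :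
    LieRing.IsNilpotent (LieIdeal.toLieSubalgebra F L (residual F L)) := by
  rw [LieAlgebra.isNilpotent_iff_forall (R := F)]
  rintro ⟨x, hx⟩
  obtain ⟨C, hC, hxC, hlie⟩ := exists_lie_mem_maximalNilpotent hdim hc hx
  have := hC.1
  obtain ⟨n, hn⟩ := exists_iterate_brk_eq_bot C
  have key : ∀ (j : ℕ) (y : LieIdeal.toLieSubalgebra F L (residual F L)),
      ((((LieAlgebra.ad F (LieIdeal.toLieSubalgebra F L (residual F L))) ⟨x, hx⟩) ^ (j + 1)) y : L) ∈
        (brk C.toSubmodule)^[j] C.toSubmodule := by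
    intro j y
    induction j with
    | zero => simpa using hlie y
    | succ j ih =>
      rw [pow_succ', Module.End.mul_apply, Function.iterate_succ_apply']
      exact lie_mem_brk hxC ih
  refine ⟨n + 1, LinearMap.ext fun y => Subtype.ext ?_⟩
  have := key n y
  rw [hn] at this
  exact (Submodule.mem_bot F).1 this

/-- A minimal supplement of the nilpotent residual is nilpotent. -/
theorem exists_isNilpotent_supplement : ∃ H : LieSubalgebra F L, LieRing.IsNilpotent H ∧
    H.toSubmodule ⊔ (residual F L).toSubmodule = ⊤ := by
  have : WellFoundedLT (LieSubalgebra F L) :=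
    StrictMono.wellFoundedLT (f := LieSubalgebra.toSubmodule) (fun _ _ h => h)
  obtain ⟨H, hH⟩ := exists_minimal_of_wellFoundedLT
    (fun H : LieSubalgebra F L => H.toSubmodule ⊔ (residual F L).toSubmodule = ⊤)
    ⟨⊤, by simp⟩
  refine ⟨H, ?_, hH.1⟩
  rw [LieAlgebra.isNilpotent_iff_forall (R := F)]
  intro h
  obtain ⟨k, hk⟩ := exists_residual_eq F L
  obtain ⟨n, hn⟩ := Filter.eventually_atTop.1
    (LinearMap.eventually_isCompl_ker_pow_range_pow (LieAlgebra.ad F H h))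
  set m := max n k
  have hcoe : ∀ (j : ℕ) (y : H), (((LieAlgebra.ad F H h) ^ j) y : L) =
      ((LieAlgebra.ad F L h) ^ j) y := by
    intro j y
    induction j with
    | zero => rfl
    | succ j ih => simp [pow_succ', ih]
  -- Fitting decomposition of ad h on H: the nil part lies in the Engel subalgebra, and the range of
  -- the m-th power lies in the m-th lower central term, which is the residual since m ≥ k. So the
  -- intersection is still a supplement, and minimality applies.
  have hle : H ≤ H ⊓ LieSubalgebra.engel F (h : L) := by
    refine hH.2 ?_ inf_le_left
    change (H ⊓ LieSubalgebra.engel F (h : L)).toSubmodule ⊔ (residual F L).toSubmodule = ⊤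
    rw [eq_top_iff, ← (hH.1 : H.toSubmodule ⊔ (residual F L).toSubmodule = ⊤)]
    refine sup_le (fun x hx => ?_) le_sup_right
    obtain ⟨a, ha, b, hb, hab⟩ := Submodule.mem_sup.1
      ((hn m (le_max_left _ _)).sup_eq_top ▸ Submodule.mem_top : (⟨x, hx⟩ : H) ∈ _)
    have hx' : x = a + b := congrArg Subtype.val hab.symm
    rw [hx']
    refine Submodule.add_mem_sup ⟨a.2, ?_⟩ ?_
    · refine (LieSubalgebra.mem_engel_iff F _ _).2 ⟨m, ?_⟩
      rw [← hcoe, LinearMap.mem_ker.1 ha]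
      rfl
    · obtain ⟨c, rfl⟩ := hb
      rw [hcoe, hk m (le_max_right _ _), Module.End.pow_apply]
      exact iterate_toEnd_mem_lowerCentralSeries F L L (h : L) (c : L) m
  rw [Module.End.isNilpotent_iff_of_finite]
  intro y
  obtain ⟨j, hj⟩ := (LieSubalgebra.mem_engel_iff F _ _).1 (hle y.2).2
  exact ⟨j, Subtype.ext ((hcoe j y).trans hj)⟩

/-- From [L,R] = R one gets R = [H,R] + [R,R], so R/[R,R] lies in the positive Fitting component of
L/[R,R] under H. The image of the nilpotent H lies in the zero weight space, and the two components
meet trivially. -/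
theorem mem_lie_residual_of_mem_supplement {H : LieSubalgebra F L} [LieRing.IsNilpotent H]
    (hH : H.toSubmodule ⊔ (residual F L).toSubmodule = ⊤) {x : L} (hx : x ∈ H)
    (hx' : x ∈ residual F L) : x ∈ ⁅residual F L, residual F L⁆ := by
  set R := residual F L with hR
  set Q : LieIdeal F L := ⁅R, R⁆ with hQ
  let π := LieSubmodule.Quotient.mk' Q
  have hRle : R.toSubmodule ≤ brk H.toSubmodule R.toSubmodule ⊔ Q.toSubmodule := by
    conv_lhs => rw [hR, ← lie_top_residual F L]
    rw [LieSubmodule.lieIdeal_oper_eq_linear_span', Submodule.span_le]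
    rintro _ ⟨a, -, b, hb, rfl⟩
    obtain ⟨h, hh, r, hr, rfl⟩ := Submodule.mem_sup.1 (hH ▸ Submodule.mem_top : a ∈ _)
    rw [add_lie]
    exact Submodule.add_mem_sup (lie_mem_brk hh hb) (LieSubmodule.lie_mem_lie hr hb)
  have hlcs : ∀ k, ∀ r ∈ R, π r ∈ lowerCentralSeries F H (L ⧸ Q) k := by
    intro k
    induction k with
    | zero => simp
    | succ k ih =>
      suffices brk H.toSubmodule R.toSubmodule ⊔ Q.toSubmodule ≤
          (lowerCentralSeries F H (L ⧸ Q) (k + 1)).toSubmodule.comap π.toLinearMap from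
        fun r hr => this (hRle hr)
      refine sup_le (brk_le.2 fun h hh r hr => ?_) fun q hq => ?_
      · change π ⁅h, r⁆ ∈ lowerCentralSeries F H (L ⧸ Q) (k + 1)
        rw [LieModuleHom.map_lie, lowerCentralSeries_succ]
        exact LieSubmodule.lie_mem_lie (x := (⟨h, hh⟩ : H)) (LieSubmodule.mem_top _) (ih r hr)
      · have : π q = 0 := (LieSubmodule.Quotient.mk_eq_zero' ).2 hq
        change π q ∈ lowerCentralSeries F H (L ⧸ Q) (k + 1)
        rw [this]
        exact zero_mem _
  have h1 : π x ∈ posFittingComp F H (L ⧸ Q) := by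
    rw [← iInf_lowerCentralSeries_eq_posFittingComp, LieSubmodule.mem_iInf]
    exact fun k => hlcs k x hx'
  have h0 : π x ∈ genWeightSpace (L ⧸ Q) (0 : H → F) := by
    rw [mem_genWeightSpace]
    intro h
    obtain ⟨k, hk⟩ := LieAlgebra.nilpotent_ad_of_nilpotent_algebra F H
    refine ⟨k, ?_⟩
    have : ∀ (j : ℕ) (y : H), ((toEnd F H (L ⧸ Q) h - (0 : H → F) h • 1) ^ j) (π y) =
        π (((LieAlgebra.ad F H h) ^ j) y : H) := by
      intro j y
      induction j with
      | zero => rfl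
      | succ j ih =>
        rw [pow_succ', pow_succ', Module.End.mul_apply, ih]
        simp [← LieModuleHom.map_lie]
    rw [this k ⟨x, hx⟩, hk h]
    simp
  have hbot := (isCompl_genWeightSpace_zero_posFittingComp F H (L ⧸ Q)).inf_eq_bot
  have : π x ∈ (⊥ : LieSubmodule F H (L ⧸ Q)) := hbot ▸ ⟨h0, h1⟩
  exact LieSubmodule.Quotient.mk_eq_zero'.1 ((LieSubmodule.mem_bot _).1 this)

end LieCIdeal

/-! ### Powers of an ideal and common eigenvectors in quotients -/

namespace LieCIdeal

open LieModule

variable {F L : Type*} [Field F] [LieRing L] [LieAlgebra F L]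

/-- Since μ is the only weight, `LinearWeights` can be checked by hand in any characteristic. -/
theorem exists_ne_zero_forall_lie_eq_smul {H M : Type*} [LieRing H] [LieAlgebra F H]
    [LieRing.IsNilpotent H] [AddCommGroup M] [Module F M] [LieRingModule H M] [LieModule F H M]
    [FiniteDimensional F M] [Nontrivial M] (μ : H →ₗ[F] F) (hμ : ∀ x y : H, μ ⁅x, y⁆ = 0)
    (h : ∀ (x : H) (m : M), ∃ k : ℕ, ((toEnd F H M x - μ x • 1) ^ k) m = 0) :
    ∃ m : M, m ≠ 0 ∧ ∀ x : H, ⁅x, m⁆ = μ x • m := by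
  have htop : genWeightSpace M (μ : H → F) = ⊤ := by
    rw [eq_top_iff]
    exact fun m _ => (mem_genWeightSpace M _ m).2 fun x => h x m
  have huniq : ∀ χ : H → F, genWeightSpace M χ ≠ ⊥ → χ = μ := by
    intro χ hχ
    by_contra hne
    have := disjoint_genWeightSpace F H M hne
    rw [htop, disjoint_top] at this
    exact hχ this
  have : LinearWeights F H M :=
    { map_add := fun χ hχ x y => by rw [huniq χ hχ, map_add]
      map_smul := fun χ hχ t x => by rw [huniq χ hχ, map_smul, smul_eq_mul]
      map_lie := fun χ hχ x y => by rw [huniq χ hχ, hμ] }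
  exact exists_forall_lie_eq_smul F H M ⟨μ, by rw [htop]; exact top_ne_bot⟩

/-- `powIdeal R n` is the `(n + 1)`-st power of the ideal `R`. -/
def powIdeal (R : LieIdeal F L) (n : ℕ) : LieIdeal F L := (fun N => ⁅R, N⁆)^[n] R

theorem powIdeal_succ (R : LieIdeal F L) (n : ℕ) :
    powIdeal R (n + 1) = ⁅R, powIdeal R n⁆ :=
  Function.iterate_succ_apply' _ _ _

theorem lie_lie_powIdeal_le (R : LieIdeal F L) (n : ℕ) :
    ⁅⁅R, R⁆, powIdeal R n⁆ ≤ powIdeal R (n + 2) := by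
  rw [LieSubmodule.lie_comm, LieSubmodule.lie_le_iff]
  intro x hx y hy
  suffices (⁅R, R⁆ : LieIdeal F L).toSubmodule ≤
      (powIdeal R (n + 2)).toSubmodule.comap (toEnd F L L x) from this hy
  rw [LieSubmodule.lieIdeal_oper_eq_linear_span', Submodule.span_le]
  rintro _ ⟨a, ha, b, hb, rfl⟩
  change ⁅x, ⁅a, b⁆⁆ ∈ powIdeal R (n + 2)
  have key : ∀ a ∈ R, ∀ b ∈ R, ⁅a, ⁅x, b⁆⁆ ∈ powIdeal R (n + 2) := by
    intro a ha b hb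
    rw [powIdeal_succ, powIdeal_succ, ← lie_skew x b]
    exact LieSubmodule.lie_mem_lie ha (neg_mem (LieSubmodule.lie_mem_lie hb hx))
  rw [leibniz_lie, ← lie_skew]
  exact add_mem (neg_mem (key b hb a ha)) (key a ha b hb)

theorem exists_powIdeal_eq_bot (R : LieIdeal F L)
    [LieRing.IsNilpotent (LieIdeal.toLieSubalgebra F L R)] : ∃ n, powIdeal R n = ⊥ := by
  obtain ⟨n, hn⟩ := exists_iterate_brk_eq_bot (LieIdeal.toLieSubalgebra F L R)
  have key : ∀ n, (powIdeal R n).toSubmodule ≤ (brk R.toSubmodule)^[n] R.toSubmodule := by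
    intro n
    induction n with
    | zero => exact le_rfl
    | succ n ih =>
      rw [powIdeal_succ, Function.iterate_succ_apply',
        LieSubmodule.lieIdeal_oper_eq_linear_span', Submodule.span_le]
      rintro _ ⟨x, hx, y, hy, rfl⟩
      exact lie_mem_brk hx (ih hy)
  refine ⟨n, ?_⟩
  rw [← LieSubmodule.toSubmodule_eq_bot, ← le_bot_iff]
  exact (key n).trans hn.le

/-- The maximal generalised eigenspace of `ad h` for the eigenvalue `c`. -/
abbrev genEig (h : L) (c : F) : Submodule F L := (toEnd F L L h).maxGenEigenspace c

theorem mem_genEig_zero {H : LieSubalgebra F L} [LieRing.IsNilpotent H] {h g : L} (hh : h ∈ H)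
    (hg : g ∈ H) : g ∈ genEig h (0 : F) := by
  obtain ⟨k, hk⟩ := LieAlgebra.nilpotent_ad_of_nilpotent_algebra F H
  rw [genEig, Module.End.mem_maxGenEigenspace]
  refine ⟨k, ?_⟩
  have : ∀ (j : ℕ) (y : H), ((toEnd F L L h - (0 : F) • 1) ^ j) (y : L) =
      (((LieAlgebra.ad F H ⟨h, hh⟩) ^ j) y : H) := by
    intro j y
    induction j with
    | zero => rfl
    | succ j ih =>
      rw [pow_succ', pow_succ', Module.End.mul_apply, ih]
      simp
  rw [this k ⟨g, hg⟩, hk ⟨h, hh⟩]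
  simp

/-- Generalised eigenvalues add under brackets, and the error terms land in the next power. The
factor is n + 1 because `powIdeal R 0` is R itself. -/
theorem powIdeal_le_genEig (R : LieIdeal F L) {h : L} {c : F}
    (hR : R.toSubmodule ≤ genEig h c ⊔ (⁅R, R⁆ : LieIdeal F L).toSubmodule) (n : ℕ) :
    (powIdeal R n).toSubmodule ≤
      genEig h ((n + 1) * c) ⊔ (powIdeal R (n + 1)).toSubmodule := by
  induction n with
  | zero =>
    rw [Nat.cast_zero, zero_add, one_mul]
    exact hR
  | succ n ih =>
    rw [powIdeal_succ R n, LieSubmodule.lieIdeal_oper_eq_linear_span', Submodule.span_le]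
    rintro _ ⟨x, hx, y, hy, rfl⟩
    obtain ⟨e, he, q, hq, rfl⟩ := Submodule.mem_sup.1 (hR hx)
    obtain ⟨e', he', r, hr, rfl⟩ := Submodule.mem_sup.1 (ih hy)
    have heR : e ∈ R := by
      have := sub_mem hx (LieSubmodule.lie_le_left R R hq)
      simpa using this
    rw [add_lie, lie_add, add_assoc ⁅e, e'⁆]
    have hqy : ⁅q, e' + r⁆ ∈ powIdeal R (n + 1 + 1) :=
      lie_lie_powIdeal_le R n (LieSubmodule.lie_mem_lie hq hy)
    refine Submodule.add_mem_sup ?_ (add_mem ?_ hqy)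
    · have := lie_mem_maxGenEigenspace_toEnd he he'
      convert this using 2
      push_cast
      ring
    · rw [powIdeal_succ R (n + 1)]
      exact LieSubmodule.lie_mem_lie heR hr

variable [FiniteDimensional F L]

/-- Above the nilpotent residual, every proper quotient has a nonzero central element. -/
theorem exists_lie_sub_smul_mem_of_residual_le {P : LieIdeal F L} (hP : P ≠ ⊤) (hR : residual F L ≤ P) :
    ∃ x ∉ P, ∀ h : L, ∃ c : F, ⁅h, x⁆ - c • x ∈ P := by
  obtain ⟨k, hk⟩ := exists_residual_eq F L
  have hex : ∃ n, lowerCentralSeries F L L n ≤ P := ⟨k, hk k le_rfl ▸ hR⟩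
  classical
  obtain ⟨m, hm⟩ : ∃ m, Nat.find hex = m + 1 := by
    refine Nat.exists_eq_succ_of_ne_zero fun h0 => hP ?_
    have := Nat.find_spec hex
    rw [h0] at this
    simpa using this
  have h1 : ¬ lowerCentralSeries F L L m ≤ P := Nat.find_min hex (by omega)
  have h2 : lowerCentralSeries F L L (m + 1) ≤ P := hm ▸ Nat.find_spec hex
  obtain ⟨x, hx, hxP⟩ := SetLike.not_le_iff_exists.1 h1
  -- x comes from the last lower central term not inside P, so it is central modulo P.
  refine ⟨x, hxP, fun h => ⟨0, ?_⟩⟩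
  rw [zero_smul, sub_zero]
  refine h2 ?_
  rw [lowerCentralSeries_succ]
  exact LieSubmodule.lie_mem_lie (LieSubmodule.mem_top h) hx

/-- Let `H` be a nilpotent supplement of a nilpotent ideal `R`. If each `h ∈ H` acts on `R / ⁅R, R⁆`
with the single generalised eigenvalue `lam h`, then `L ⧸ P` has a common eigenvector whenever
`R` is not contained in `P`. -/
theorem exists_lie_sub_smul_mem {H : LieSubalgebra F L} [LieRing.IsNilpotent H]
    {R P : LieIdeal F L} (hH : H.toSubmodule ⊔ R.toSubmodule = ⊤)
    [LieRing.IsNilpotent (LieIdeal.toLieSubalgebra F L R)]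
    {lam : L →ₗ[F] F} (hlam : ∀ x y : L, lam ⁅x, y⁆ = 0)
    (hR : ∀ h ∈ H, R.toSubmodule ≤ genEig h (lam h) ⊔ (⁅R, R⁆ : LieIdeal F L).toSubmodule)
    (hRP : ¬ R ≤ P) : ∃ x ∉ P, ∀ h : L, ∃ c : F, ⁅h, x⁆ - c • x ∈ P := by
  have hex : ∃ n, powIdeal R n ≤ P := by
    obtain ⟨n, hn⟩ := exists_powIdeal_eq_bot R
    exact ⟨n, hn ▸ bot_le⟩
  classical
  obtain ⟨m, hm⟩ : ∃ m, Nat.find hex = m + 1 := by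
    refine Nat.exists_eq_succ_of_ne_zero fun h0 => hRP ?_
    have := Nat.find_spec hex
    rw [h0] at this
    exact this
  have h1 : ¬ powIdeal R m ≤ P := Nat.find_min hex (by omega)
  have h2 : powIdeal R (m + 1) ≤ P := hm ▸ Nat.find_spec hex
  let π := LieSubmodule.Quotient.mk' P
  -- Image of the last power of R not inside P: R annihilates it, so an eigenvector for H is one for
  -- L = H + R.
  let N : LieSubmodule F H (L ⧸ P) :=
    { (powIdeal R m).toSubmodule.map π.toLinearMap with
      lie_mem := by
        rintro h _ ⟨y, hy, rfl⟩
        exact ⟨⁅(h : L), y⁆, lie_mem_right F L _ _ _ hy, π.map_lie _ _⟩ }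
  obtain ⟨x0, hx0, hx0P⟩ := SetLike.not_le_iff_exists.1 h1
  have : Nontrivial N := ⟨⟨⟨π x0, x0, hx0, rfl⟩, 0, fun h => hx0P
    (LieSubmodule.Quotient.mk_eq_zero'.1 (congrArg Subtype.val h))⟩⟩
  obtain ⟨⟨_, x, hx, rfl⟩, hn0, hx'⟩ := exists_ne_zero_forall_lie_eq_smul (H := H) (M := N)
    (((m + 1 : F) • lam) ∘ₗ H.toSubmodule.subtype)
    (fun a b => by
      change (m + 1 : F) • lam ⁅(a : L), (b : L)⁆ = 0
      rw [hlam, smul_zero])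
    (by
      rintro h ⟨_, y, hy, rfl⟩
      obtain ⟨e, he, r, hr, rfl⟩ := Submodule.mem_sup.1
        (powIdeal_le_genEig R (hR h h.2) m hy)
      obtain ⟨k, hk⟩ := (Module.End.mem_maxGenEigenspace _ _ _).1 he
      refine ⟨k, Subtype.ext ?_⟩
      set c : F := (m + 1 : F) * lam h
      let T : Module.End F N := toEnd F H N h - c • 1
      have hpow : ∀ (j : ℕ) (z : L) (hz : π z ∈ N), ((T ^ j) ⟨π z, hz⟩ : L ⧸ P) =
          π (((toEnd F L L (h : L) - c • (1 : Module.End F L)) ^ j) z) := by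
        intro j z hz
        induction j with
        | zero => rfl
        | succ j ih =>
          rw [pow_succ', pow_succ', Module.End.mul_apply, Module.End.mul_apply]
          change ⁅(h : L), ((T ^ j) ⟨π z, hz⟩ : L ⧸ P)⁆ - c • ((T ^ j) ⟨π z, hz⟩ : L ⧸ P) = _
          rw [ih, ← LieModuleHom.map_lie, ← map_smul, ← map_sub]
          rfl
      refine (hpow k (e + r) _).trans (LieSubmodule.Quotient.mk_eq_zero'.2 ?_)
      rw [map_add, hk, zero_add]
      have hstab : ∀ j, ((toEnd F L L (h : L) - c • (1 : Module.End F L)) ^ j) r ∈ P := by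
        intro j
        induction j with
        | zero => exact h2 hr
        | succ j ih =>
          rw [pow_succ', Module.End.mul_apply]
          exact sub_mem (lie_mem_right F L P _ _ ih) (P.smul_mem _ ih)
      exact hstab k)
  refine ⟨x, fun hxP => hn0 (Subtype.ext (LieSubmodule.Quotient.mk_eq_zero'.2 hxP)), fun a => ?_⟩
  obtain ⟨h, hh, r, hr, rfl⟩ := Submodule.mem_sup.1 (hH ▸ Submodule.mem_top : a ∈ _)
  refine ⟨(m + 1 : F) * lam h, ?_⟩
  have e1 : ⁅h, x⁆ - ((m + 1 : F) * lam h) • x ∈ P := by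
    have := congrArg Subtype.val (hx' ⟨h, hh⟩)
    refine LieSubmodule.Quotient.mk_eq_zero'.1 ?_
    change π _ = 0
    rw [map_sub, map_smul, LieModuleHom.map_lie, sub_eq_zero]
    exact this
  have e2 : ⁅r, x⁆ ∈ P := h2 (by
    rw [powIdeal_succ]
    exact LieSubmodule.lie_mem_lie hr hx)
  rw [add_lie, add_sub_right_comm]
  exact add_mem e1 e2

/-! ### Building the chain of ideals -/

/-- If every proper ideal `P` admits a common eigenvector in `L ⧸ P`, then `L` is
supersolvable. -/
theorem isSupersolvable_of_forall_exists
    (h : ∀ P : LieIdeal F L, P ≠ ⊤ → ∃ x ∉ P, ∀ h : L, ∃ c : F, ⁅h, x⁆ - c • x ∈ P) :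
    IsSupersolvable F L := by
  have hstep : ∀ P : LieIdeal F L, ∃ Q : LieIdeal F L, P ≤ Q ∧
      (P ≠ ⊤ → Module.finrank F Q = Module.finrank F P + 1) := by
    intro P
    by_cases hP : P = ⊤
    · exact ⟨P, le_rfl, fun h => (h hP).elim⟩
    obtain ⟨x, hxP, hx⟩ := h P hP
    let Q : LieIdeal F L :=
      { P.toSubmodule ⊔ F ∙ x with
        lie_mem := by
          intro a b hb
          obtain ⟨p, hp, y, hy, rfl⟩ := Submodule.mem_sup.1 hb
          obtain ⟨t, rfl⟩ := Submodule.mem_span_singleton.1 hy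
          obtain ⟨c, hc⟩ := hx a
          have : ⁅a, p + t • x⁆ = (⁅a, p⁆ + t • (⁅a, x⁆ - c • x)) + (t * c) • x := by
            rw [lie_add, lie_smul, smul_sub, mul_smul]
            abel
          change ⁅a, p + t • x⁆ ∈ P.toSubmodule ⊔ F ∙ x
          rw [this]
          exact Submodule.add_mem_sup
            (add_mem (lie_mem_right F L P a p hp) (P.smul_mem t hc))
            (Submodule.smul_mem _ _ (Submodule.mem_span_singleton_self x)) }
    refine ⟨Q, le_sup_left (a := P.toSubmodule), fun _ => ?_⟩
    have hx0 : x ≠ 0 := fun h => hxP (h ▸ zero_mem P)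
    have hinf : P.toSubmodule ⊓ F ∙ x = ⊥ :=
      ((Submodule.disjoint_span_singleton' hx0).2 hxP).eq_bot
    have := Submodule.finrank_sup_add_finrank_inf_eq P.toSubmodule (F ∙ x)
    rw [hinf, finrank_bot, finrank_span_singleton hx0] at this
    exact this
  choose g hg hg' using hstep
  have hfin : ∀ n ≤ Module.finrank F L, Module.finrank F (g^[n] ⊥ : LieIdeal F L) = n := by
    intro n
    induction n with
    | zero => intro _; exact finrank_bot F L
    | succ n ih =>
      intro hn
      have ih' := ih (by omega)
      rw [Function.iterate_succ_apply', hg', ih']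
      intro htop
      rw [htop] at ih'
      have : Module.finrank F (⊤ : LieIdeal F L) = Module.finrank F L := finrank_top F L
      omega
  refine ⟨Module.finrank F L, fun n => g^[n] ⊥, ?_, rfl, ?_, hfin⟩
  · refine monotone_nat_of_le_succ fun n => ?_
    rw [Function.iterate_succ_apply']
    exact hg _
  · rw [← LieSubmodule.toSubmodule_eq_top]
    exact Submodule.eq_top_of_finrank_eq (hfin _ le_rfl)

end LieCIdeal

/-! ### The character on the residual, and the conclusion -/

namespace LieCIdeal

open LieModule

variable {F L : Type*} [Field F] [LieRing L] [LieAlgebra F L]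

/-- Modulo the derived algebra of a maximal nilpotent subalgebra containing it, the nilpotent
residual is acted on by scalars. -/
theorem MaximalSubalgebrasAreCIdeals.exists_character (hc : MaximalSubalgebrasAreCIdeals F L)
    {C : LieSubalgebra F L} (hC : IsMaximalNilpotent C)
    (hRC : (residual F L).toSubmodule ≤ C.toSubmodule)
    (hR : ¬ (residual F L).toSubmodule ≤ brk C.toSubmodule C.toSubmodule) :
    ∃ lam : L →ₗ[F] F, (∀ x y : L, lam ⁅x, y⁆ = 0) ∧
      ∀ h : L, ∀ x ∈ residual F L, ⁅h, x⁆ - lam h • x ∈ brk C.toSubmodule C.toSubmodule := by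
  have := hC.1
  set R := residual F L with hRdef
  obtain ⟨x₁, hx₁, hx₁'⟩ := SetLike.not_le_iff_exists.1 hR
  obtain ⟨f, hfx, hf⟩ := Submodule.exists_le_ker_of_notMem hx₁'
  obtain ⟨x₀, hx₀, hfx₀⟩ : ∃ x₀ ∈ R, f x₀ = 1 :=
    ⟨(f x₁)⁻¹ • x₁, R.smul_mem _ hx₁, by simp [hfx]⟩
  let lam : L →ₗ[F] F :=
    { toFun := fun h => f ⁅h, x₀⁆
      map_add' := fun a b => by simp
      map_smul' := fun c a => by simp }
  -- ker f ∩ R is L-stable, so L acts on the line R/(ker f ∩ R), spanned by x₀.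
  have hlam : ∀ h : L, ∀ x ∈ R, f ⁅h, x⁆ = lam h * f x := by
    intro h x hx
    have hy : x - f x • x₀ ∈ R := sub_mem hx (R.smul_mem _ hx₀)
    have := (hc.lie_mem hC hf (hRC hx₀) (by simp [hfx₀]) (hRC hy) hy (by simp [hfx₀]) h).2
    rw [lie_sub, lie_smul, map_sub, map_smul, sub_eq_zero, smul_eq_mul] at this
    rw [this, mul_comm]
    rfl
  have hspan : ∀ h : L, ∀ x ∈ R, ⁅h, x⁆ ∈ F ∙ x ⊔ brk C.toSubmodule C.toSubmodule := by
    intro h x hx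
    by_contra hcon
    obtain ⟨φ, hφ, hφ'⟩ := Submodule.exists_le_ker_of_notMem hcon
    -- ⁅h, x⁆ itself witnesses that ker φ cuts out a proper hyperplane of C; this hyperplane
    -- contains x, hence also ⁅h, x⁆, a contradiction.
    exact hφ (hc.lie_mem hC (le_sup_right.trans hφ') (hRC (lie_mem_right F L R h x hx)) hφ
      (hRC hx) hx ((le_sup_left.trans hφ') (Submodule.mem_span_singleton_self x)) h).2
  have hne : ∀ h : L, ∀ x ∈ R, f x ≠ 0 →
      ⁅h, x⁆ - lam h • x ∈ brk C.toSubmodule C.toSubmodule := by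
    intro h x hx hfx
    obtain ⟨y, hy, w, hw, hyw⟩ := Submodule.mem_sup.1 (hspan h x hx)
    obtain ⟨c, rfl⟩ := Submodule.mem_span_singleton.1 hy
    have h1 := hlam h x hx
    have hfw : f w = 0 := hf hw
    rw [← hyw, map_add, map_smul, hfw, add_zero, smul_eq_mul] at h1
    rw [← mul_right_cancel₀ hfx h1, ← hyw, add_sub_cancel_left]
    exact hw
  refine ⟨lam, fun x y => ?_, fun h x hx => ?_⟩
  · change f ⁅⁅x, y⁆, x₀⁆ = 0
    rw [lie_lie, map_sub, hlam x _ (lie_mem_right F L R y x₀ hx₀),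
      hlam y _ (lie_mem_right F L R x x₀ hx₀), hlam x _ hx₀, hlam y _ hx₀]
    ring
  -- Where f vanishes, write x as the difference of x + x₀ and x₀, on both of which f is nonzero.
  · by_cases hfx : f x = 0
    · have h1 := sub_mem (hne h (x + x₀) (add_mem hx hx₀) (by simp [hfx, hfx₀]))
        (hne h x₀ hx₀ (by simp [hfx₀]))
      rw [lie_add, smul_add] at h1
      convert h1 using 1
      abel
    · exact hne h x hx hfx

variable [FiniteDimensional F L]

/-- Splitting C along H + R gives [C,C] ≤ H + [C,R]. For an element of R the H-part lies in H ∩ R ≤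
[R,R] ≤ [C,R]. -/
theorem residual_inf_brk_le {H C : LieSubalgebra F L} [LieRing.IsNilpotent H]
    (hH : H.toSubmodule ⊔ (residual F L).toSubmodule = ⊤)
    (hRC : (residual F L).toSubmodule ≤ C.toSubmodule) :
    (residual F L).toSubmodule ⊓ brk C.toSubmodule C.toSubmodule ≤
      brk C.toSubmodule (residual F L).toSubmodule := by
  set R := residual F L
  have hbrkR : brk C.toSubmodule R.toSubmodule ≤ R.toSubmodule :=
    brk_le.2 fun x _ y hy => lie_mem_right F L R x y hy
  have hle : brk C.toSubmodule C.toSubmodule ≤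
      H.toSubmodule ⊔ brk C.toSubmodule R.toSubmodule := by
    refine brk_le.2 fun x hx y hy => ?_
    obtain ⟨h, hh, r, hr, rfl⟩ := Submodule.mem_sup.1 (hH ▸ Submodule.mem_top : x ∈ _)
    obtain ⟨g, hg, s, hs, rfl⟩ := Submodule.mem_sup.1 (hH ▸ Submodule.mem_top : y ∈ _)
    have hhC : h ∈ C := by simpa using C.sub_mem hx (hRC hr)
    rw [lie_add, add_lie, add_assoc]
    refine Submodule.add_mem_sup (H.lie_mem hh hg) (add_mem ?_ (lie_mem_brk hx hs))
    rw [brk_comm]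
    have hgC : g ∈ C := by simpa using C.sub_mem hy (hRC hs)
    exact lie_mem_brk hr hgC
  rintro x ⟨hxR, hx⟩
  obtain ⟨h, hh, y, hy, rfl⟩ := Submodule.mem_sup.1 (hle hx)
  refine add_mem ?_ hy
  have hhR : h ∈ R := by simpa using sub_mem hxR (hbrkR hy)
  have hh2 := mem_lie_residual_of_mem_supplement hH hh hhR
  have hQ : (⁅R, R⁆ : LieIdeal F L).toSubmodule ≤ brk C.toSubmodule R.toSubmodule := by
    rw [LieSubmodule.lieIdeal_oper_eq_linear_span', Submodule.span_le]
    rintro _ ⟨a, ha, b, hb, rfl⟩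
    exact lie_mem_brk (hRC ha) hb
  exact hQ hh2

/-- The subspace E = (`genEig h c` ∩ R) + [R,R] is an ideal, because ad h is nilpotent on H and so H
preserves the generalised eigenspace. Fitting for ad h - c on R gives R ≤ E + [C,R], and Nakayama
over C removes [C,R]. -/
theorem residual_le_genEig {H C : LieSubalgebra F L} [LieRing.IsNilpotent H]
    [LieRing.IsNilpotent C] (hH : H.toSubmodule ⊔ (residual F L).toSubmodule = ⊤)
    (hRC : (residual F L).toSubmodule ≤ C.toSubmodule) {h : L} (hh : h ∈ H) {c : F}
    (hc : ∀ x ∈ residual F L, ⁅h, x⁆ - c • x ∈ brk C.toSubmodule (residual F L).toSubmodule) :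
    (residual F L).toSubmodule ≤
      genEig h c ⊔ (⁅residual F L, residual F L⁆ : LieIdeal F L).toSubmodule := by
  set R := residual F L with hRdef
  set Q : LieIdeal F L := ⁅R, R⁆ with hQ
  have hQR : Q ≤ R := LieSubmodule.lie_le_left R R
  set E : Submodule F L := (genEig h c ⊓ R.toSubmodule) ⊔ Q.toSubmodule with hE
  have hER : E ≤ R.toSubmodule := sup_le inf_le_right hQR
  have hinv : ∀ a : L, ∀ x ∈ E, ⁅a, x⁆ ∈ E := by
    intro a x hx
    have hxR := hER hx
    obtain ⟨e, he, q, hq, rfl⟩ := Submodule.mem_sup.1 hx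
    obtain ⟨g, hg, r, hr, rfl⟩ := Submodule.mem_sup.1 (hH ▸ Submodule.mem_top : a ∈ _)
    rw [add_lie, lie_add, add_assoc]
    refine Submodule.add_mem_sup ⟨?_, lie_mem_right F L R _ _ he.2⟩
      (add_mem (lie_mem_right F L Q _ _ hq) (LieSubmodule.lie_mem_lie hr hxR))
    have := lie_mem_maxGenEigenspace_toEnd (mem_genEig_zero (F := F) hh hg) he.1
    rwa [zero_add] at this
  suffices R.toSubmodule ≤ E from this.trans (sup_le_sup_right inf_le_left _)
  refine le_of_le_sup_brk C hRC (brk_le.2 fun a _ x hx => hinv a x hx) fun x hx => ?_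
  let T : Module.End F R := toEnd F L R h - c • 1
  have hT : ∀ (j : ℕ) (y : R), ((T ^ j) y : L) = ((toEnd F L L h - c • 1) ^ j) (y : L) := by
    intro j y
    induction j with
    | zero => rfl
    | succ j ih =>
      rw [pow_succ', pow_succ', Module.End.mul_apply, Module.End.mul_apply, ← ih]
      rfl
  obtain ⟨n, hn⟩ := Filter.eventually_atTop.1 (LinearMap.eventually_isCompl_ker_pow_range_pow T)
  -- The exponent n + 1 leaves one factor T to pull out, and T maps R into [C,R].
  obtain ⟨a, ha, b, ⟨y, rfl⟩, hab⟩ := Submodule.mem_sup.1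
    ((hn (n + 1) (by omega)).sup_eq_top ▸ Submodule.mem_top : (⟨x, hx⟩ : R) ∈ _)
  have hx' : x = a + ((T ^ (n + 1)) y : R) := congrArg Subtype.val hab.symm
  rw [hx']
  refine Submodule.add_mem_sup (Submodule.mem_sup_left ⟨?_, a.2⟩) ?_
  · refine (Module.End.mem_maxGenEigenspace _ _ _).2 ⟨n + 1, ?_⟩
    rw [← hT, LinearMap.mem_ker.1 ha]
    rfl
  · rw [pow_succ', Module.End.mul_apply]
    exact hc _ ((T ^ n) y).2

theorem isSupersolvable_of_maximalSubalgebrasAreCIdeals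
    (hdim : ∀ C : LieSubalgebra F L, IsMaximalNilpotent C → 2 ≤ Module.finrank F C)
    (hc : MaximalSubalgebrasAreCIdeals F L) : IsSupersolvable F L := by
  refine isSupersolvable_of_forall_exists fun P hP => ?_
  by_cases hRP : residual F L ≤ P
  · exact exists_lie_sub_smul_mem_of_residual_le hP hRP
  have hnil := isNilpotent_residual hdim hc
  obtain ⟨C, hC, hRC⟩ := exists_isMaximalNilpotent_ge _ hnil
  replace hRC : (residual F L).toSubmodule ≤ C.toSubmodule := hRC
  obtain ⟨H, hHnil, hH⟩ := exists_isNilpotent_supplement (F := F) (L := L)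
  have hCnil := hC.1
  have hinf := residual_inf_brk_le hH hRC
  -- Otherwise R ≤ R ∩ [C,C] ≤ [C,R], and Nakayama forces R = 0 ≤ P.
  have hR : ¬ (residual F L).toSubmodule ≤ brk C.toSubmodule C.toSubmodule := by
    intro hle
    have h1 : (residual F L).toSubmodule ≤ ⊥ := by
      refine le_of_le_sup_brk C hRC
        (brk_le.2 fun a _ b hb => by simp [(Submodule.mem_bot F).1 hb]) ?_
      rw [bot_sup_eq]
      exact (le_inf le_rfl hle).trans hinf
    exact hRP (h1.trans bot_le)
  obtain ⟨lam, hlam, hlam'⟩ := hc.exists_character hC hRC hR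
  refine exists_lie_sub_smul_mem hH hlam (fun h hh => ?_) hRP
  refine residual_le_genEig hH hRC hh fun x hx => hinf ⟨?_, hlam' h x hx⟩
  exact sub_mem (lie_mem_right F L _ h x hx) ((residual F L).smul_mem _ hx)

end LieCIdeal

theorem corollaryc {F L : Type*} [Field F] [LieRing L] [LieAlgebra F L] [FiniteDimensional F L]
    (hdim : ∀ C : LieSubalgebra F L, LieCIdeal.IsMaximalNilpotent C → 2 ≤ Module.finrank F C)
    (hc : ∀ C : LieSubalgebra F L, LieCIdeal.IsMaximalNilpotent C →
      ∀ B : LieSubalgebra F L, LieCIdeal.IsMaximalSubalgebraOf B C → LieCIdeal.IsCIdeal B) :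
    LieCIdeal.IsSupersolvable F L :=
  LieCIdeal.isSupersolvable_of_maximalSubalgebrasAreCIdeals hdim hc
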